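/- Let $X$ be a (paracompact, Hausdorff, smooth) manifold. A (hermitian) bundle gerbe $(L,Y)$ over $X$ consists of a surjective submersion $\pi\colon Y\to X$, a smooth hermitian line bundle $L\to Y^{[2]}=Y\times_X Y$, and a smooth hermitian isomorphism $L_{(y_1,y_2)}\otimes L_{(y_2,y_3)}\to L_{(y_1,y_3)}$, defined for all $(y_1,y_2),(y_2,y_3)\in Y^{[2]}$, that is associative. A bundle gerbe module of rank $r$ for $(L,Y)$ is a smooth hermitian vector bundle $E\to Y$ of finite rank $r$ with a smooth hermitian isomorphism $L_{(y_1,y_2)}\otimes E_{y_2}\to E_{y_1}$, $(y_1,y_2)\in Y^{[2]}$, such that the two induced maps $L_{(y_1,y_2)}\otimes L_{(y_2,y_3)}\otimes E_{y_3}\to E_{y_1}$ agree. The Dixmier–Douady class $d(L)\in H^3(X,\mathbb Z)$ (Čech cohomology) is obtained as follows: choose an open cover $\{U_\alpha\}$ of $X$ with smooth sections $s_\alpha\colon U_\alpha\to Y$ of $\pi$, fine enough that there are smooth unit sections $\sigma_{\alpha\beta}$ of $(s_\alpha,s_\beta)^{-1}L$ over $U_\alpha\cap U_\beta$ and continuous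 functions $w_{\alpha\beta\gamma}\colon U_\alpha\cap U_\beta\cap U_\gamma\to\mathbb R$ with $\sigma_{\alpha\beta}\sigma_{\beta\gamma}=e^{2\pi i w_{\alpha\beta\gamma}}\,\sigma_{\alpha\gamma}$; then $d(L)$ is the class of the integral Čech cocycle $\delta w$. Proposition. If a bundle gerbe $(L,Y)$ over $X$ has a bundle gerbe module $E\to Y$ of rank $r$, then its Dixmier–Douady class satisfies $r\,d(L)=0$ in $H^3(X,\mathbb Z)$. (Precisely: choices as above exist, and for every such choice $r$ times the resulting class is $0$.) -/

import Mathlib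

open scoped Manifold ContDiff Topology TensorProduct InnerProductSpace

noncomputable section

/-! ### Čech cohomology with integer coefficients -/

namespace CechZ

universe u

/-- An open cover of `X`, indexed by an arbitrary type. -/
structure OpenCover (X : Type u) [TopologicalSpace X] where
  ι : Type u
  U : ι → Set X
  isOpen : ∀ α, IsOpen (U α)
  exists_mem : ∀ x, ∃ α, x ∈ U α

variable {X : Type u} [TopologicalSpace X]

/-- The intersection `U_{τ 0} ∩ ⋯ ∩ U_{τ p}`. -/
def OpenCover.inter (𝒰 : OpenCover X) {p : ℕ} (τ : Fin (p + 1) → 𝒰.ι) : Set X :=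
  {x | ∀ k, x ∈ 𝒰.U (τ k)}

/-- The inclusion of an intersection into the intersection with the `k`-th index omitted. -/
def OpenCover.face (𝒰 : OpenCover X) {p : ℕ} (τ : Fin (p + 2) → 𝒰.ι) (k : Fin (p + 2)) :
    C(𝒰.inter τ, 𝒰.inter (τ ∘ k.succAbove)) where
  toFun x := ⟨x.1, fun l => x.2 (k.succAbove l)⟩
  continuous_toFun := by fun_prop

/-- Čech `p`-cochains of the cover `𝒰` with values in the constant sheaf `ℤ`. -/
abbrev Cochain (𝒰 : OpenCover X) (p : ℕ) : Type u :=
  (τ : Fin (p + 1) → 𝒰.ι) → LocallyConstant (𝒰.inter τ) ℤ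

/-- The Čech differential `(δ c)_τ = ∑ₖ (-1)ᵏ c_{τ without its k-th entry}`. -/
def d (𝒰 : OpenCover X) (p : ℕ) : Cochain 𝒰 p →+ Cochain 𝒰 (p + 1) where
  toFun c τ := ∑ k : Fin (p + 2), (-1 : ℤ) ^ (k : ℕ) •
    LocallyConstant.comap (𝒰.face τ k) (c (τ ∘ k.succAbove))
  map_zero' := by
    funext τ
    refine Finset.sum_eq_zero fun k _ => ?_
    ext x
    simp
  map_add' a b := by
    funext τ
    rw [Pi.add_apply, ← Finset.sum_add_distrib]
    refine Finset.sum_congr rfl fun k _ => ?_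
    rw [← smul_add]
    rfl

theorem d_apply (𝒰 : OpenCover X) (p : ℕ) (c : Cochain 𝒰 p) (τ : Fin (p + 2) → 𝒰.ι)
    (x : 𝒰.inter τ) :
    d 𝒰 p c τ x = ∑ k : Fin (p + 2), (-1 : ℤ) ^ (k : ℕ) * c (τ ∘ k.succAbove) (𝒰.face τ k x) := by
  change LocallyConstant.coeFnAddMonoidHom (∑ k : Fin (p + 2), (-1 : ℤ) ^ (k : ℕ) •
    LocallyConstant.comap (𝒰.face τ k) (c (τ ∘ k.succAbove))) x = _
  rw [map_sum, Finset.sum_apply]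
  rfl

/-- Čech `p`-cocycles. -/
def cocycles (𝒰 : OpenCover X) (p : ℕ) : AddSubgroup (Cochain 𝒰 p) := (d 𝒰 p).ker

/-- Čech `p`-coboundaries. -/
def coboundaries (𝒰 : OpenCover X) : (p : ℕ) → AddSubgroup (Cochain 𝒰 p)
  | 0 => ⊥
  | p + 1 => (d 𝒰 p).range

/-- The Čech cohomology group `Hᵖ(𝒰, ℤ)` of a cover. -/
abbrev CoverH (𝒰 : OpenCover X) (p : ℕ) : Type u :=
  cocycles 𝒰 p ⧸ (coboundaries 𝒰 p).addSubgroupOf (cocycles 𝒰 p)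

/-- `𝒱` refines `𝒰` along the map `ρ` of index sets. -/
structure Refinement (𝒱 𝒰 : OpenCover X) where
  ρ : 𝒱.ι → 𝒰.ι
  le : ∀ β, 𝒱.U β ⊆ 𝒰.U (ρ β)

namespace Refinement

variable {𝒱 𝒰 : OpenCover X} (R : Refinement 𝒱 𝒰)

/-- The inclusion `V_{τ 0} ∩ ⋯ ∩ V_{τ p} ⊆ U_{ρ (τ 0)} ∩ ⋯ ∩ U_{ρ (τ p)}`. -/
def incl {p : ℕ} (τ : Fin (p + 1) → 𝒱.ι) : C(𝒱.inter τ, 𝒰.inter (R.ρ ∘ τ)) where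
  toFun x := ⟨x.1, fun k => R.le _ (x.2 k)⟩
  continuous_toFun := by fun_prop

/-- Restriction of cochains along a refinement. -/
def pull (p : ℕ) : Cochain 𝒰 p →+ Cochain 𝒱 p where
  toFun c τ := LocallyConstant.comap (R.incl τ) (c (R.ρ ∘ τ))
  map_zero' := rfl
  map_add' _ _ := rfl

theorem d_pull (p : ℕ) (c : Cochain 𝒰 p) : d 𝒱 p (R.pull p c) = R.pull (p + 1) (d 𝒰 p c) := by
  funext τ
  ext x
  rw [d_apply]
  exact (d_apply 𝒰 p c (R.ρ ∘ τ) (R.incl τ x)).symm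

/-- Restriction of cocycles along a refinement. -/
def pullCocycles (p : ℕ) : cocycles 𝒰 p →+ cocycles 𝒱 p :=
  ((R.pull p).comp (cocycles 𝒰 p).subtype).codRestrict (cocycles 𝒱 p) fun c => by
    change d 𝒱 p (R.pull p c.1) = 0
    rw [d_pull, show d 𝒰 p c.1 = 0 from c.2, map_zero]

/-- Restriction `Hᵖ(𝒰, ℤ) → Hᵖ(𝒱, ℤ)` along a refinement. -/
def pullH (p : ℕ) : CoverH 𝒰 p →+ CoverH 𝒱 p :=
  QuotientAddGroup.map _ _ (R.pullCocycles p) <| by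
    rintro ⟨c, hc⟩ h
    change R.pull p c ∈ coboundaries 𝒱 p
    change c ∈ coboundaries 𝒰 p at h
    cases p with
    | zero =>
      have h0 : c = 0 := h
      rw [h0, map_zero]
      exact zero_mem _
    | succ p =>
      obtain ⟨b, rfl⟩ := h
      exact ⟨R.pull p b, R.d_pull p b⟩

end Refinement

open Classical in
/-- The relations of the direct limit: a class on `𝒰` is identified with its restriction to any
refinement of `𝒰`. -/
def relations (X : Type u) [TopologicalSpace X] (p : ℕ) :
    AddSubgroup (DirectSum (OpenCover X) fun 𝒰 => CoverH 𝒰 p) :=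
  AddSubgroup.closure {z | ∃ (𝒱 𝒰 : OpenCover X) (R : Refinement 𝒱 𝒰) (a : CoverH 𝒰 p),
    z = DirectSum.of (fun 𝒰 => CoverH 𝒰 p) 𝒱 (R.pullH p a) -
      DirectSum.of (fun 𝒰 => CoverH 𝒰 p) 𝒰 a}

/-- The Čech cohomology group `Hᵖ(X, ℤ)`: the direct limit (colimit of abelian groups) of the
groups `Hᵖ(𝒰, ℤ)` over all open covers `𝒰` of `X` and all their refinements. -/
abbrev H (X : Type u) [TopologicalSpace X] (p : ℕ) : Type (u + 1) :=
  DirectSum (OpenCover X) (fun 𝒰 => CoverH 𝒰 p) ⧸ relations X p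

open Classical in
/-- The class in `Hᵖ(X, ℤ)` of a Čech cocycle of a cover. -/
def H.mk (𝒰 : OpenCover X) {p : ℕ} (n : cocycles 𝒰 p) : H X p :=
  QuotientAddGroup.mk (DirectSum.of (fun 𝒰 => CoverH 𝒰 p) 𝒰 (QuotientAddGroup.mk n))

end CechZ

/-! ### Smooth hermitian vector bundles

The bases that occur are a manifold `Y` and its fibre products over `X`, which are submanifolds of
the powers of `Y`. Both are treated as a space `B` with an inclusion `j : B → M` into a manifold,
a function on `B` being smooth if it extends locally to a smooth function on `M`. -/

set_option linter.checkUnivs false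

namespace Gerbe

universe u v w v' w'

section Bundles

variable {EM HM : Type*} [NormedAddCommGroup EM] [NormedSpace ℝ EM] [TopologicalSpace HM]
  (I : ModelWithCorners ℝ EM HM) {M : Type*} [TopologicalSpace M] [ChartedSpace HM M]
  {B : Type*} [TopologicalSpace B] (j : B → M)

/-- The complex function `f` on the subspace `j : B → M` is smooth at `b`: near `b` it is the
restriction of a function on `M` that is smooth at `j b`. -/
def SmoothAt (f : B → ℂ) (b : B) : Prop :=
  ∃ F : M → ℂ, ContMDiffAt I 𝓘(ℝ, ℂ) ∞ F (j b) ∧ ∀ᶠ b' in 𝓝 b, f b' = F (j b')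

/-- A smooth hermitian complex vector bundle of rank `r` over `B`: a family of hermitian vector
spaces with an atlas of local orthonormal frames whose transition functions are smooth.
(The value of `frame i a` outside `dom i` is irrelevant.) -/
structure HermitianBundle (r : ℕ) where
  fiber : B → Type w
  [normed : ∀ b, NormedAddCommGroup (fiber b)]
  [hermitian : ∀ b, InnerProductSpace ℂ (fiber b)]
  ι : Type v
  dom : ι → Set B
  isOpen_dom : ∀ i, IsOpen (dom i)
  exists_mem_dom : ∀ b, ∃ i, b ∈ dom i
  frame : ι → Fin r → (b : B) → fiber b
  orthonormal : ∀ i, ∀ b ∈ dom i, Orthonormal ℂ fun a => frame i a b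
  span_eq_top : ∀ i, ∀ b ∈ dom i, Submodule.span ℂ (Set.range fun a => frame i a b) = ⊤
  smooth_transition : ∀ i i' a a', ∀ b ∈ dom i ∩ dom i',
    SmoothAt I j (fun b' => inner ℂ (frame i a b') (frame i' a' b')) b

attribute [instance] HermitianBundle.normed HermitianBundle.hermitian

end Bundles

/-! ### Bundle gerbes and bundle gerbe modules -/

section FibreProducts

variable {X Y : Type*}

/-- The fibre product `Y^[2] = Y ×_X Y`. -/
abbrev Y2 (π : Y → X) : Type _ := {y : Y × Y // π y.1 = π y.2}

/-- The fibre product `Y^[3] = Y ×_X Y ×_X Y`. -/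
abbrev Y3 (π : Y → X) : Type _ := {y : Y × Y × Y // π y.1 = π y.2.1 ∧ π y.2.1 = π y.2.2}

variable {π : Y → X}

/-- The point `(y₁, y₂)` of `Y^[2]`. -/
abbrev pair {y₁ y₂ : Y} (h : π y₁ = π y₂) : Y2 π := ⟨(y₁, y₂), h⟩

end FibreProducts

variable {EX EY : Type*} [NormedAddCommGroup EX] [NormedSpace ℝ EX]
  [NormedAddCommGroup EY] [NormedSpace ℝ EY]
  {X : Type u} [TopologicalSpace X] [ChartedSpace EX X]
  {Y : Type*} [TopologicalSpace Y] [ChartedSpace EY Y]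

/-- A (hermitian) bundle gerbe `(L, Y)` over `X`: a surjective submersion `π : Y → X`, a hermitian
line bundle `L` over `Y^[2]` and a smooth associative hermitian product
`L_{(y₁,y₂)} ⊗ L_{(y₂,y₃)} ≃ L_{(y₁,y₃)}`. -/
structure BundleGerbe (EX EY : Type*) [NormedAddCommGroup EX] [NormedSpace ℝ EX]
    [NormedAddCommGroup EY] [NormedSpace ℝ EY]
    {X Y : Type*} [TopologicalSpace X] [ChartedSpace EX X] [TopologicalSpace Y]
    [ChartedSpace EY Y] (π : Y → X) where
  submersion : Manifold.IsSubmersion 𝓘(ℝ, EY) 𝓘(ℝ, EX) ∞ π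
  surjective : Function.Surjective π
  L : HermitianBundle.{v, w} (𝓘(ℝ, EY).prod 𝓘(ℝ, EY)) (Subtype.val : Y2 π → Y × Y) 1
  mul : ∀ {y₁ y₂ y₃ : Y} (h : π y₁ = π y₂) (h' : π y₂ = π y₃),
    L.fiber (pair h) ⊗[ℂ] L.fiber (pair h') ≃ₗᵢ[ℂ] L.fiber (pair (h.trans h'))
  mul_assoc : ∀ {y₁ y₂ y₃ y₄ : Y} (h : π y₁ = π y₂) (h' : π y₂ = π y₃) (h'' : π y₃ = π y₄)
    (a : L.fiber (pair h)) (b : L.fiber (pair h')) (c : L.fiber (pair h'')),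
    mul (h.trans h') h'' (mul h h' (a ⊗ₜ b) ⊗ₜ c) =
      mul h (h'.trans h'') (a ⊗ₜ mul h' h'' (b ⊗ₜ c))
  smooth_mul : ∀ (i i' i'' : L.ι) (t : Y3 π),
    pair t.2.1 ∈ L.dom i → pair t.2.2 ∈ L.dom i' → pair (t.2.1.trans t.2.2) ∈ L.dom i'' →
    SmoothAt (𝓘(ℝ, EY).prod (𝓘(ℝ, EY).prod 𝓘(ℝ, EY))) (Subtype.val : Y3 π → Y × Y × Y)
      (fun s => inner ℂ (L.frame i'' 0 (pair (s.2.1.trans s.2.2)))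
        (mul s.2.1 s.2.2 (L.frame i 0 (pair s.2.1) ⊗ₜ L.frame i' 0 (pair s.2.2)))) t

namespace BundleGerbe

variable {π : Y → X} (G : BundleGerbe.{v, w} EX EY π)

/-- A bundle gerbe module of rank `r`: a hermitian vector bundle `E` of rank `r` over `Y` with a
smooth hermitian isomorphism `L_{(y₁,y₂)} ⊗ E_{y₂} ≃ E_{y₁}` that is compatible with the product
of the bundle gerbe. -/
structure GerbeModule (r : ℕ) where
  E : HermitianBundle.{v', w'} 𝓘(ℝ, EY) (id : Y → Y) r
  act : ∀ {y₁ y₂ : Y} (h : π y₁ = π y₂), G.L.fiber (pair h) ⊗[ℂ] E.fiber y₂ ≃ₗᵢ[ℂ] E.fiber y₁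
  mul_act : ∀ {y₁ y₂ y₃ : Y} (h : π y₁ = π y₂) (h' : π y₂ = π y₃)
    (a : G.L.fiber (pair h)) (b : G.L.fiber (pair h')) (e : E.fiber y₃),
    act (h.trans h') (G.mul h h' (a ⊗ₜ b) ⊗ₜ e) = act h (a ⊗ₜ act h' (b ⊗ₜ e))
  smooth_act : ∀ (i : G.L.ι) (k k' : E.ι) (a a' : Fin r) (t : Y2 π),
    t ∈ G.L.dom i → t.1.2 ∈ E.dom k → t.1.1 ∈ E.dom k' →
    SmoothAt (𝓘(ℝ, EY).prod 𝓘(ℝ, EY)) (Subtype.val : Y2 π → Y × Y)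
      (fun s => inner ℂ (E.frame k' a' s.1.1)
        (act s.2 (G.L.frame i 0 (pair s.2) ⊗ₜ E.frame k a s.1.2))) t

/-- The local data that compute the Dixmier–Douady class: an open cover `U_α` of `X`, smooth
sections `s_α : U_α → Y` of `π`, smooth unit sections `σ_{αβ}` of `(s_α, s_β)⁻¹ L` over
`U_α ∩ U_β`, the `U(1)`-valued cocycle `g = exp (2 π i w)` with
`σ_{αβ} σ_{βγ} = g_{αβγ} σ_{αγ}`, and the integral cocycle `n = δ w` that represents the image of
the class of `g` under the connecting map of `0 → ℤ → ℝ → U(1) → 0`.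
(A continuous logarithm of the smooth function `g` is smooth.) -/
structure LocalData where
  𝒰 : CechZ.OpenCover X
  s : 𝒰.ι → X → Y
  smooth_s : ∀ α, ContMDiffOn 𝓘(ℝ, EX) 𝓘(ℝ, EY) ∞ (s α) (𝒰.U α)
  π_s : ∀ {α x}, x ∈ 𝒰.U α → π (s α x) = x
  σ : ∀ (α β : 𝒰.ι) {x : X} (hα : x ∈ 𝒰.U α) (hβ : x ∈ 𝒰.U β),
    G.L.fiber (pair ((π_s hα).trans (π_s hβ).symm))
  norm_σ : ∀ (α β : 𝒰.ι) {x : X} (hα : x ∈ 𝒰.U α) (hβ : x ∈ 𝒰.U β), ‖σ α β hα hβ‖ = 1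
  smooth_σ : ∀ (α β : 𝒰.ι) (i : G.L.ι) (x : {x : X // x ∈ 𝒰.U α ∧ x ∈ 𝒰.U β}),
    pair ((π_s x.2.1).trans (π_s x.2.2).symm) ∈ G.L.dom i →
    SmoothAt 𝓘(ℝ, EX) (Subtype.val : {x : X // x ∈ 𝒰.U α ∧ x ∈ 𝒰.U β} → X)
      (fun z => inner ℂ (G.L.frame i 0 (pair ((π_s z.2.1).trans (π_s z.2.2).symm)))
        (σ α β z.2.1 z.2.2)) x
  w : (τ : Fin 3 → 𝒰.ι) → 𝒰.inter τ → ℝ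
  continuous_w : ∀ τ, Continuous (w τ)
  mul_σ : ∀ (τ : Fin 3 → 𝒰.ι) (x : 𝒰.inter τ),
    G.mul _ _ (σ (τ 0) (τ 1) (x.2 0) (x.2 1) ⊗ₜ σ (τ 1) (τ 2) (x.2 1) (x.2 2)) =
      Complex.exp (2 * Real.pi * Complex.I * w τ x) • σ (τ 0) (τ 2) (x.2 0) (x.2 2)
  n : CechZ.cocycles 𝒰 3
  n_eq : ∀ (τ : Fin 4 → 𝒰.ι) (x : 𝒰.inter τ),
    (n.1 τ x : ℝ) = ∑ k : Fin 4, (-1 : ℝ) ^ (k : ℕ) * w (τ ∘ k.succAbove) (𝒰.face τ k x)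

/-- `c` is the Dixmier–Douady class of the bundle gerbe: it is computed by some choice of local
data. -/
def IsDixmierDouadyClass (c : CechZ.H X 3) : Prop :=
  ∃ D : G.LocalData, c = CechZ.H.mk D.𝒰 D.n

end BundleGerbe

end Gerbe

end

/-!
Let `s_α` be local sections of `π` over a cover and `σ_{αβ}` unit sections of `(s_α, s_β)⁻¹ L` with
`σ_{αβ} σ_{βγ} = g_{αβγ} σ_{αγ}`. After a refinement each `s_α⁻¹ E` has an orthonormal frame, and in
these frames `σ_{αβ}` acts by a unitary matrix `A_{αβ}`. Compatibility of the action with the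
product of the gerbe gives `g_{αβγ} A_{αγ} = A_{αβ} A_{βγ}`, and determinants give
`gʳ = δ (det A)`. On a further refinement `det A = exp (2 π i u)` with `u` continuous, so for
`g = exp (2 π i w)` the cochain `r w - δ u` is integral, and its coboundary is `r δ w`. Hence `r`
times the Dixmier–Douady class vanishes (`LocalData.nsmul_mk_eq_zero`).

That local data exist at all needs sections of `π` (`exists_contMDiffOn_section`, read off from the
normal form of a submersion), frames of `L` over the double intersections and logarithms over the
triple ones. Usually the last two come from a good cover. Here they come from a property of
paracompact Hausdorff spaces: a cover can be refined so that every nonempty `(p + 1)`-fold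
intersection is small inside the corresponding intersection of the original cover
(`OpenCover.exists_refinement_inter_subset`), whence local choices on intersections become global
ones. The same lemma provides the logarithm `u` above (`OpenCover.exists_refinement_exp_eq`).
-/

noncomputable section

/-! ### Refinements adapted to the intersections of a cover -/

namespace CechZ

universe u

variable {X : Type u} [TopologicalSpace X]

theorem OpenCover.isOpen_inter (𝒰 : OpenCover X) {p : ℕ} (τ : Fin (p + 1) → 𝒰.ι) :
    IsOpen (𝒰.inter τ) := by
  have : 𝒰.inter τ = ⋂ k, 𝒰.U (τ k) := by
    ext x
    simp [OpenCover.inter]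
  rw [this]
  exact isOpen_iInter_of_finite fun k => 𝒰.isOpen _

/-- On a paracompact Hausdorff space, any local choice on the `(p + 1)`-fold intersections of a
cover can be made on the whole of each intersection after passing to a refinement. This is what
replaces the existence of good covers. -/
theorem OpenCover.exists_refinement_inter_subset [T2Space X] [ParacompactSpace X]
    (𝒰 : OpenCover X) {p : ℕ} (N : (Fin (p + 1) → 𝒰.ι) → X → Set X)
    (hN : ∀ τ, ∀ x ∈ 𝒰.inter τ, N τ x ∈ 𝓝 x) :
    ∃ (𝒱 : OpenCover X) (R : Refinement 𝒱 𝒰), ∀ τ : Fin (p + 1) → 𝒱.ι, (𝒱.inter τ).Nonempty →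
      ∃ x ∈ 𝒰.inter (R.ρ ∘ τ), 𝒱.inter τ ⊆ N (R.ρ ∘ τ) x := by
  obtain ⟨v, vo, vc, vf, vU⟩ := precise_refinement 𝒰.U 𝒰.isOpen
    (Set.iUnion_eq_univ_iff.2 𝒰.exists_mem)
  obtain ⟨w, wc, wo, wv⟩ := exists_iUnion_eq_closure_subset vo (fun x => vf.point_finite x) vc
  choose ρ hρ using Set.iUnion_eq_univ_iff.1 wc
  have wf : LocallyFinite fun α => closure (w α) := vf.subset wv
  -- The member around `x` lies in `w (ρ x)`, avoids every `closure (w α)` not containing `x`, and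
  -- lies in `N τ x` for the finitely many `τ` with entries among the `α` with `x ∈ v α`.
  let V : X → Set X := fun x => interior (w (ρ x) ∩
    (⋂ α, ⋂ _ : x ∉ closure (w α), (closure (w α))ᶜ) ∩
    ⋂ τ ∈ Set.pi Set.univ (fun _ : Fin (p + 1) => {α | x ∈ v α}), N τ x)
  have hV : ∀ x, x ∈ V x := by
    intro x
    refine mem_interior_iff_mem_nhds.2 (Filter.inter_mem (Filter.inter_mem
      ((wo _).mem_nhds (hρ x)) (wf.iInter_compl_mem_nhds (fun _ => isClosed_closure) x)) ?_)
    refine (Filter.biInter_mem (Set.Finite.pi fun _ => vf.point_finite x)).2 fun τ hτ => ?_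
    exact hN τ x fun k => vU _ (hτ k trivial)
  refine ⟨⟨X, V, fun x => isOpen_interior, fun x => ⟨x, hV x⟩⟩,
    ⟨ρ, fun x z hz => vU _ (wv _ (subset_closure (interior_subset hz).1.1))⟩, ?_⟩
  rintro τ ⟨z, hz⟩
  have key : ∀ k, τ 0 ∈ v (ρ (τ k)) := by
    intro k
    by_contra hk
    have h1 : τ 0 ∉ closure (w (ρ (τ k))) := fun h => hk (wv _ h)
    have h2 := (interior_subset (hz 0)).1.2
    simp only [Set.mem_iInter] at h2
    exact h2 _ h1 (subset_closure (interior_subset (hz k)).1.1)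
  refine ⟨τ 0, fun k => vU _ (key k), fun y hy => ?_⟩
  have h3 := (interior_subset (hy 0)).2
  simp only [Set.mem_iInter] at h3
  exact h3 _ fun k _ => key k

/-! ### Logarithms and integral cochains -/

/-- Continuous `U(1)`-valued functions on the intersections of a cover acquire continuous
logarithms on a refinement. -/
theorem OpenCover.exists_refinement_exp_eq [T2Space X] [ParacompactSpace X]
    (𝒰 : OpenCover X) {p : ℕ} (g : (τ : Fin (p + 1) → 𝒰.ι) → 𝒰.inter τ → ℂ)
    (hg : ∀ τ, Continuous (g τ)) (hg1 : ∀ τ x, ‖g τ x‖ = 1) :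
    ∃ (𝒱 : OpenCover X) (R : Refinement 𝒱 𝒰) (u : (τ : Fin (p + 1) → 𝒱.ι) → 𝒱.inter τ → ℝ),
      (∀ τ, Continuous (u τ)) ∧ ∀ τ x,
        Complex.exp (2 * Real.pi * Complex.I * u τ x) = g (R.ρ ∘ τ) (R.incl τ x) := by
  have hg0 : ∀ τ x, g τ x ≠ 0 := fun τ x h => by
    have := hg1 τ x
    simp [h] at this
  obtain ⟨𝒱, R, h𝒱⟩ := 𝒰.exists_refinement_inter_subset
    (fun τ x => {z | ∀ (hx : x ∈ 𝒰.inter τ) (hz : z ∈ 𝒰.inter τ),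
      g τ ⟨z, hz⟩ / g τ ⟨x, hx⟩ ∈ Complex.slitPlane}) (by
    intro τ x hx
    have hc : ContinuousAt (fun z => g τ z / g τ ⟨x, hx⟩) ⟨x, hx⟩ :=
      ((hg τ).div_const _).continuousAt
    have h1 : {z | g τ z / g τ ⟨x, hx⟩ ∈ Complex.slitPlane} ∈ 𝓝 (⟨x, hx⟩ : 𝒰.inter τ) := by
      refine hc.preimage_mem_nhds (Complex.isOpen_slitPlane.mem_nhds ?_)
      rw [div_self (hg0 _ _)]
      exact Complex.one_mem_slitPlane
    rw [mem_nhds_subtype_iff_nhdsWithin, (𝒰.isOpen_inter τ).nhdsWithin_eq hx] at h1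
    filter_upwards [h1] with z hz _ hz'
    obtain ⟨y, hy, rfl⟩ := hz
    exact hy)
  have : ∀ τ : Fin (p + 1) → 𝒱.ι, ∃ u : 𝒱.inter τ → ℝ, Continuous u ∧ ∀ x,
      Complex.exp (2 * Real.pi * Complex.I * u x) = g (R.ρ ∘ τ) (R.incl τ x) := by
    intro τ
    by_cases hne : (𝒱.inter τ).Nonempty
    · obtain ⟨x, hx, hsub⟩ := h𝒱 τ hne
      set c := g (R.ρ ∘ τ) ⟨x, hx⟩ with hc
      refine ⟨fun z => ((g (R.ρ ∘ τ) (R.incl τ z) / c).arg + c.arg) / (2 * Real.pi), ?_, ?_⟩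
      · refine Continuous.div_const (Continuous.add ?_ continuous_const) _
        refine continuous_iff_continuousAt.2 fun z => ?_
        exact ContinuousAt.comp (f := fun z => g (R.ρ ∘ τ) (R.incl τ z) / c)
          (Complex.continuousAt_arg (hsub z.2 hx (R.incl τ z).2))
          ((((hg _).comp (R.incl τ).continuous).div_const _).continuousAt)
      · intro z
        have e1 : ∀ a : ℂ, ‖a‖ = 1 → Complex.exp (a.arg * Complex.I) = a := fun a ha => by
          have := Complex.norm_mul_exp_arg_mul_I a
          rwa [ha, Complex.ofReal_one, one_mul] at this
        have hpi : (Real.pi : ℂ) ≠ 0 := by exact_mod_cast Real.pi_ne_zero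
        have e2 : 2 * Real.pi * Complex.I *
            (((g (R.ρ ∘ τ) (R.incl τ z) / c).arg + c.arg) / (2 * Real.pi) : ℝ) =
            (g (R.ρ ∘ τ) (R.incl τ z) / c).arg * Complex.I + c.arg * Complex.I := by
          push_cast
          field_simp
        rw [e2, Complex.exp_add, e1 _ (by rw [norm_div, hg1, hc, hg1, div_one]), e1 _ (hg1 _ _),
          div_mul_cancel₀ _ (hg0 _ _)]
    · exact ⟨fun _ => 0, continuous_const, fun x => (hne ⟨x, x.2⟩).elim⟩
  choose u hu hu' using this
  exact ⟨𝒱, R, u, hu, hu'⟩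

/-- A continuous real function with `exp (2 π i f) = 1` is a locally constant integer. -/
theorem exists_locallyConstant_eq {T : Type*} [TopologicalSpace T] {f : T → ℝ} (hf : Continuous f)
    (h : ∀ x, Complex.exp (2 * Real.pi * Complex.I * f x) = 1) :
    ∃ n : LocallyConstant T ℤ, ∀ x, (n x : ℝ) = f x := by
  have : ∀ x, ∃ n : ℤ, (n : ℝ) = f x := by
    intro x
    obtain ⟨n, hn⟩ := Complex.exp_eq_one_iff.1 (h x)
    have h2 : (2 * Real.pi * Complex.I : ℂ) ≠ 0 := Complex.two_pi_I_ne_zero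
    rw [mul_comm] at hn
    exact ⟨n, by exact_mod_cast (mul_right_cancel₀ h2 hn).symm⟩
  choose n hn using this
  refine ⟨⟨n, (IsLocallyConstant.iff_continuous n).2 ?_⟩, hn⟩
  rw [Int.isClosedEmbedding_coe_real.isInducing.continuous_iff]
  exact hf.congr fun x => (hn x).symm

/-- `δ δ = 0` for functions on index tuples. -/
theorem sum_sum_succAbove_eq_zero {ι : Type*} {p : ℕ} (c : (Fin (p + 1) → ι) → ℝ)
    (τ : Fin (p + 3) → ι) :
    ∑ k : Fin (p + 3), (-1 : ℝ) ^ (k : ℕ) * ∑ l : Fin (p + 2), (-1 : ℝ) ^ (l : ℕ) *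
      c ((τ ∘ k.succAbove) ∘ l.succAbove) = 0 := by
  simp_rw [Finset.mul_sum]
  rw [← Finset.sum_product' (f := fun (k : Fin (p + 3)) (l : Fin (p + 2)) =>
    (-1 : ℝ) ^ (k : ℕ) * ((-1 : ℝ) ^ (l : ℕ) * c ((τ ∘ k.succAbove) ∘ l.succAbove)))]
  -- Deleting `k` and then `l` cancels against deleting the same two entries in the other order.
  refine Finset.sum_involution (fun a _ => (a.1.succAbove a.2, a.2.predAbove a.1)) ?_ ?_
    (fun _ _ => Finset.mem_univ _) ?_
  · rintro ⟨k, l⟩ -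
    have h : (τ ∘ (k.succAbove l).succAbove) ∘ (l.predAbove k).succAbove =
        (τ ∘ k.succAbove) ∘ l.succAbove := by
      funext m
      simp [Fin.succAbove_succAbove_succAbove_predAbove]
    simp only [h, ← mul_assoc, ← pow_add, Fin.neg_one_pow_succAbove_add_predAbove]
    ring
  · rintro ⟨k, l⟩ - - h
    exact Fin.succAbove_ne k l (Prod.ext_iff.1 h).1
  · rintro ⟨k, l⟩ -
    simp [Fin.succAbove_succAbove_predAbove, Fin.predAbove_predAbove_succAbove]

/-- `δ δ = 0` for real functions on the intersections of a cover. -/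
theorem OpenCover.sum_sum_face_eq_zero (𝒰 : OpenCover X) {p : ℕ}
    (u : (τ : Fin (p + 1) → 𝒰.ι) → 𝒰.inter τ → ℝ) (τ : Fin (p + 3) → 𝒰.ι) (x : 𝒰.inter τ) :
    ∑ k : Fin (p + 3), (-1 : ℝ) ^ (k : ℕ) * ∑ l : Fin (p + 2), (-1 : ℝ) ^ (l : ℕ) *
      u ((τ ∘ k.succAbove) ∘ l.succAbove) (𝒰.face _ l (𝒰.face τ k x)) = 0 := by
  classical
  rw [← sum_sum_succAbove_eq_zero
    (fun τ' => if h : x.1 ∈ 𝒰.inter τ' then u τ' ⟨x.1, h⟩ else 0) τ]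
  refine Finset.sum_congr rfl fun k _ => ?_
  congr 1
  refine Finset.sum_congr rfl fun l _ => ?_
  rw [dif_pos (show x.1 ∈ 𝒰.inter ((τ ∘ k.succAbove) ∘ l.succAbove) from fun m => x.2 _)]
  rfl

/-- Multiplication by `r` kills the class of a cocycle once `r` times its restriction to some
refinement is a coboundary. -/
theorem H.nsmul_mk_eq_zero {𝒱 𝒰 : OpenCover X} (R : Refinement 𝒱 𝒰) {p : ℕ} (r : ℕ)
    (n : cocycles 𝒰 (p + 1)) (m : Cochain 𝒱 p) (h : d 𝒱 p m = r • R.pull (p + 1) n.1) :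
    r • H.mk 𝒰 n = 0 := by
  classical
  have h1 : H.mk 𝒱 (R.pullCocycles (p + 1) n) = H.mk 𝒰 n := by
    refine (QuotientAddGroup.eq_iff_sub_mem).2 (AddSubgroup.subset_closure ?_)
    exact ⟨𝒱, 𝒰, R, QuotientAddGroup.mk n, rfl⟩
  have h2 : (r • (QuotientAddGroup.mk (R.pullCocycles (p + 1) n) : CoverH 𝒱 (p + 1))) = 0 := by
    rw [← QuotientAddGroup.mk_nsmul, QuotientAddGroup.eq_zero_iff]
    exact ⟨m, h⟩
  rw [← h1]
  unfold H.mk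
  rw [← QuotientAddGroup.mk_nsmul, ← map_nsmul, h2, map_zero]
  rfl

end CechZ

/-! ### Smooth functions and orthonormal frames -/

namespace Gerbe

universe u v w v' w'

section Bundles

variable {EM HM : Type*} [NormedAddCommGroup EM] [NormedSpace ℝ EM] [TopologicalSpace HM]
  {I : ModelWithCorners ℝ EM HM} {M : Type*} [TopologicalSpace M] [ChartedSpace HM M]
  {B : Type*} [TopologicalSpace B] {j : B → M}
  {EM' HM' : Type*} [NormedAddCommGroup EM'] [NormedSpace ℝ EM'] [TopologicalSpace HM']
  {I' : ModelWithCorners ℝ EM' HM'} {M' : Type*} [TopologicalSpace M'] [ChartedSpace HM' M']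
  {B' : Type*} [TopologicalSpace B'] {j' : B' → M'}

theorem SmoothAt.continuousAt {f : B → ℂ} {b : B} (h : SmoothAt I j f b) (hj : ContinuousAt j b) :
    ContinuousAt f b := by
  obtain ⟨F, hF, hfF⟩ := h
  exact (hF.continuousAt.comp hj).congr (hfF.mono fun _ h => h.symm)

/-- Smooth functions pull back along a continuous map of subspaces that is the restriction of a
smooth map of the ambient manifolds. -/
theorem SmoothAt.comp {f : B → ℂ} {φ : B' → B} {z : B'} (hf : SmoothAt I j f (φ z))
    (hφ : ContinuousAt φ z) {Φ : M' → M} (hΦ : ContMDiffAt I' I ∞ Φ (j' z))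
    (h : ∀ z, j (φ z) = Φ (j' z)) : SmoothAt I' j' (fun z => f (φ z)) z := by
  obtain ⟨F, hF, hfF⟩ := hf
  rw [h] at hF
  refine ⟨F ∘ Φ, hF.comp _ hΦ, ?_⟩
  filter_upwards [hφ.eventually hfF] with z' hz'
  rw [hz', h]
  rfl

namespace HermitianBundle

variable {r : ℕ} (E : HermitianBundle.{v, w} I j r)

/-- The orthonormal basis of a fibre given by a local frame. -/
def basis {i : E.ι} {b : B} (hb : b ∈ E.dom i) : OrthonormalBasis (Fin r) ℂ (E.fiber b) :=
  OrthonormalBasis.mk (E.orthonormal i b hb) (E.span_eq_top i b hb).ge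

theorem basis_apply {i : E.ι} {b : B} (hb : b ∈ E.dom i) (a : Fin r) :
    E.basis hb a = E.frame i a b := by
  simp [basis]

theorem sum_inner_smul_frame {i : E.ι} {b : B} (hb : b ∈ E.dom i) (v : E.fiber b) :
    ∑ a, inner ℂ (E.frame i a b) v • E.frame i a b = v := by
  simpa only [basis_apply] using (E.basis hb).sum_repr' v

theorem sum_inner_mul_inner_frame {i : E.ι} {b : B} (hb : b ∈ E.dom i) (u v : E.fiber b) :
    ∑ a, inner ℂ u (E.frame i a b) * inner ℂ (E.frame i a b) v = inner ℂ u v := by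
  simpa only [basis_apply] using (E.basis hb).sum_inner_mul_inner u v

theorem inner_smul_frame (L : HermitianBundle.{v, w} I j 1) {i : L.ι} {b : B} (hb : b ∈ L.dom i)
    (v : L.fiber b) : inner ℂ (L.frame i 0 b) v • L.frame i 0 b = v := by
  simpa using L.sum_inner_smul_frame hb v

theorem norm_frame {i : E.ι} {b : B} (hb : b ∈ E.dom i) (a : Fin r) : ‖E.frame i a b‖ = 1 :=
  (E.orthonormal i b hb).1 a

end HermitianBundle

end Bundles

/-! ### Local sections of submersions -/

variable {EX EY : Type*} [NormedAddCommGroup EX] [NormedSpace ℝ EX]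
  [NormedAddCommGroup EY] [NormedSpace ℝ EY]
  {X : Type u} [TopologicalSpace X] [ChartedSpace EX X]
  {Y : Type*} [TopologicalSpace Y] [ChartedSpace EY Y]

theorem exists_contMDiffOn_section [IsManifold 𝓘(ℝ, EX) ∞ X] [IsManifold 𝓘(ℝ, EY) ∞ Y]
    {π : Y → X} (hπ : Manifold.IsSubmersion 𝓘(ℝ, EY) 𝓘(ℝ, EX) ∞ π) (y : Y) :
    ∃ (U : Set X) (s : X → Y), IsOpen U ∧ π y ∈ U ∧
      ContMDiffOn 𝓘(ℝ, EX) 𝓘(ℝ, EY) ∞ s U ∧ ∀ x ∈ U, π (s x) = x := by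
  obtain ⟨F, _, _, h⟩ := hπ
  replace h := h y
  set φ := h.domChart
  set ψ := h.codChart
  set e := h.equiv
  have hφ := h.mem_domChart_source
  have hw : ∀ z ∈ φ.target, ψ (π (φ.symm z)) = (e z).1 := fun z hz => by
    have hz' : z ∈ (φ.extend 𝓘(ℝ, EY)).target := by
      simpa [OpenPartialHomeomorph.extend_target] using hz
    simpa using h.writtenInCharts hz'
  -- In charts where `π` is the projection `(u, v) ↦ u`, the section is `u ↦ (u, v₀)`.
  let q : EX → EY := fun u => e.symm (u, (e (φ y)).2)
  have hq : ContDiff ℝ ∞ q := e.symm.contDiff.comp (contDiff_id.prodMk contDiff_const)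
  have hqs : ∀ x ∈ ψ.source ∩ ψ ⁻¹' (q ⁻¹' φ.target), π (φ.symm (q (ψ x))) = x := by
    rintro x ⟨hx, hx'⟩
    refine ψ.injOn (h.source_subset_preimage_source (φ.map_target hx')) hx ?_
    rw [hw _ hx']
    simp [q]
  refine ⟨ψ.source ∩ ψ ⁻¹' (q ⁻¹' φ.target), fun x => φ.symm (q (ψ x)),
    ψ.isOpen_inter_preimage (φ.open_target.preimage hq.continuous), ⟨h.mem_codChart_source, ?_⟩,
    ?_, hqs⟩
  · have h1 := hw (φ y) (φ.map_source hφ)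
    rw [φ.left_inv hφ] at h1
    change q (ψ (π y)) ∈ φ.target
    rw [h1]
    have : q (e (φ y)).1 = φ y := e.symm_apply_apply _
    rw [this]
    exact φ.map_source hφ
  · have h1 : ContMDiffOn 𝓘(ℝ, EX) 𝓘(ℝ, EX) ∞ ψ ψ.source :=
      contMDiffOn_of_mem_maximalAtlas h.codChart_mem_maximalAtlas
    have h2 : ContMDiffOn 𝓘(ℝ, EY) 𝓘(ℝ, EY) ∞ φ.symm φ.target :=
      contMDiffOn_symm_of_mem_maximalAtlas h.domChart_mem_maximalAtlas
    exact h2.comp (hq.contMDiff.comp_contMDiffOn (h1.mono Set.inter_subset_left))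
      fun x hx => hx.2

namespace BundleGerbe

variable {π : Y → X} (G : BundleGerbe.{v, w} EX EY π)

/-! ### Existence of the local data -/

theorem norm_mul {y₁ y₂ y₃ : Y} (h : π y₁ = π y₂) (h' : π y₂ = π y₃) (a : G.L.fiber (pair h))
    (b : G.L.fiber (pair h')) : ‖G.mul h h' (a ⊗ₜ b)‖ = ‖a‖ * ‖b‖ := by
  rw [LinearIsometryEquiv.norm_map, TensorProduct.norm_tmul]

/-- An open cover with smooth sections `s_α` of `π` such that a single local frame of `L`
trivialises `(s_α, s_β)⁻¹ L` over each nonempty `U_α ∩ U_β`. -/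
structure LocalFrames where
  𝒰 : CechZ.OpenCover X
  s : 𝒰.ι → X → Y
  smooth_s : ∀ α, ContMDiffOn 𝓘(ℝ, EX) 𝓘(ℝ, EY) ∞ (s α) (𝒰.U α)
  π_s : ∀ {α x}, x ∈ 𝒰.U α → π (s α x) = x
  idx : ∀ α β, (𝒰.U α ∩ 𝒰.U β).Nonempty → G.L.ι
  mem_dom : ∀ {α β x} (hα : x ∈ 𝒰.U α) (hβ : x ∈ 𝒰.U β),
    pair ((π_s hα).trans (π_s hβ).symm) ∈ G.L.dom (idx α β ⟨x, hα, hβ⟩)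

namespace LocalFrames

variable {G} (A : G.LocalFrames)

/-- The unit section of `(s_α, s_β)⁻¹ L` given by the local frame. -/
def σ (α β : A.𝒰.ι) {x : X} (hα : x ∈ A.𝒰.U α) (hβ : x ∈ A.𝒰.U β) :
    G.L.fiber (pair ((A.π_s hα).trans (A.π_s hβ).symm)) :=
  G.L.frame (A.idx α β ⟨x, hα, hβ⟩) 0 _

theorem norm_σ (α β : A.𝒰.ι) {x : X} (hα : x ∈ A.𝒰.U α) (hβ : x ∈ A.𝒰.U β) :
    ‖A.σ α β hα hβ‖ = 1 :=
  G.L.norm_frame (A.mem_dom hα hβ) 0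

theorem continuousOn_s (α : A.𝒰.ι) : ContinuousOn (A.s α) (A.𝒰.U α) :=
  (A.smooth_s α).continuousOn

theorem smooth_σ (α β : A.𝒰.ι) (i : G.L.ι) (x : {x : X // x ∈ A.𝒰.U α ∧ x ∈ A.𝒰.U β})
    (hx : pair ((A.π_s x.2.1).trans (A.π_s x.2.2).symm) ∈ G.L.dom i) :
    SmoothAt 𝓘(ℝ, EX) (Subtype.val : {x : X // x ∈ A.𝒰.U α ∧ x ∈ A.𝒰.U β} → X)
      (fun z => inner ℂ (G.L.frame i 0 (pair ((A.π_s z.2.1).trans (A.π_s z.2.2).symm)))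
        (A.σ α β z.2.1 z.2.2)) x := by
  have hα := (A.smooth_s α).contMDiffAt ((A.𝒰.isOpen α).mem_nhds x.2.1)
  have hβ := (A.smooth_s β).contMDiffAt ((A.𝒰.isOpen β).mem_nhds x.2.2)
  refine SmoothAt.comp (j' := Subtype.val) (I' := 𝓘(ℝ, EX))
    (φ := fun z : {x : X // x ∈ A.𝒰.U α ∧ x ∈ A.𝒰.U β} =>
      (pair ((A.π_s z.2.1).trans (A.π_s z.2.2).symm) : Y2 π))
    (Φ := fun x => (A.s α x, A.s β x))
    (G.L.smooth_transition i (A.idx α β ⟨x, x.2⟩) 0 0 _ ⟨hx, A.mem_dom x.2.1 x.2.2⟩) ?_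
    (hα.prodMk hβ) fun _ => rfl
  refine Topology.IsInducing.subtypeVal.continuousAt_iff.2 ?_
  exact (hα.continuousAt.comp continuousAt_subtype_val).prodMk
    (hβ.continuousAt.comp continuousAt_subtype_val)

/-- The function `g_{αβγ}` with `σ_{αβ} σ_{βγ} = g_{αβγ} σ_{αγ}`. -/
def g (α β γ : A.𝒰.ι) {x : X} (hα : x ∈ A.𝒰.U α) (hβ : x ∈ A.𝒰.U β) (hγ : x ∈ A.𝒰.U γ) : ℂ :=
  inner ℂ (A.σ α γ hα hγ) (G.mul _ _ (A.σ α β hα hβ ⊗ₜ A.σ β γ hβ hγ))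

theorem mul_σ (α β γ : A.𝒰.ι) {x : X} (hα : x ∈ A.𝒰.U α) (hβ : x ∈ A.𝒰.U β)
    (hγ : x ∈ A.𝒰.U γ) :
    G.mul _ _ (A.σ α β hα hβ ⊗ₜ A.σ β γ hβ hγ) = A.g α β γ hα hβ hγ • A.σ α γ hα hγ :=
  (G.L.inner_smul_frame (A.mem_dom hα hγ) _).symm

theorem norm_g (α β γ : A.𝒰.ι) {x : X} (hα : x ∈ A.𝒰.U α) (hβ : x ∈ A.𝒰.U β)
    (hγ : x ∈ A.𝒰.U γ) : ‖A.g α β γ hα hβ hγ‖ = 1 := by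
  have h := congrArg norm (A.mul_σ α β γ hα hβ hγ)
  rw [norm_mul, norm_smul, norm_σ, norm_σ, norm_σ, mul_one, mul_one] at h
  exact h.symm

/-- `g` is a `U(1)`-valued Čech cocycle, by the associativity of the product. -/
theorem g_mul_g (α β γ δ : A.𝒰.ι) {x : X} (hα : x ∈ A.𝒰.U α) (hβ : x ∈ A.𝒰.U β)
    (hγ : x ∈ A.𝒰.U γ) (hδ : x ∈ A.𝒰.U δ) :
    A.g α β γ hα hβ hγ * A.g α γ δ hα hγ hδ = A.g β γ δ hβ hγ hδ * A.g α β δ hα hβ hδ := by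
  have h := G.mul_assoc _ _ _ (A.σ α β hα hβ) (A.σ β γ hβ hγ) (A.σ γ δ hγ hδ)
  rw [mul_σ, mul_σ, TensorProduct.tmul_smul, ← TensorProduct.smul_tmul', map_smul, map_smul,
    mul_σ, mul_σ, smul_smul, smul_smul] at h
  refine smul_left_injective ℂ (fun h0 => ?_) h
  have := A.norm_σ α δ hα hδ
  rw [h0, norm_zero] at this
  exact zero_ne_one this

theorem continuous_g (τ : Fin 3 → A.𝒰.ι) :
    Continuous fun x : A.𝒰.inter τ => A.g (τ 0) (τ 1) (τ 2) (x.2 0) (x.2 1) (x.2 2) := by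
  refine continuous_iff_continuousAt.2 fun x => ?_
  have hs : ∀ k, Continuous fun z : A.𝒰.inter τ => A.s (τ k) z := fun k =>
    (A.continuousOn_s (τ k)).comp_continuous continuous_subtype_val fun z => z.2 k
  let t : A.𝒰.inter τ → Y3 π := fun z => ⟨(A.s (τ 0) z, A.s (τ 1) z, A.s (τ 2) z),
    (A.π_s (z.2 0)).trans (A.π_s (z.2 1)).symm, (A.π_s (z.2 1)).trans (A.π_s (z.2 2)).symm⟩
  have ht : Continuous t := ((hs 0).prodMk ((hs 1).prodMk (hs 2))).subtype_mk _
  have h := (G.smooth_mul (A.idx (τ 0) (τ 1) ⟨x, x.2 0, x.2 1⟩)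
    (A.idx (τ 1) (τ 2) ⟨x, x.2 1, x.2 2⟩) (A.idx (τ 0) (τ 2) ⟨x, x.2 0, x.2 2⟩) (t x)
    (A.mem_dom (x.2 0) (x.2 1)) (A.mem_dom (x.2 1) (x.2 2))
    (A.mem_dom (x.2 0) (x.2 2))).continuousAt continuousAt_subtype_val
  exact ContinuousAt.comp (f := t) h ht.continuousAt

/-- Restriction of the sections and frames along a refinement of the cover. -/
def restrict {𝒱 : CechZ.OpenCover X} (R : CechZ.Refinement 𝒱 A.𝒰) : G.LocalFrames where
  𝒰 := 𝒱
  s β := A.s (R.ρ β)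
  smooth_s β := (A.smooth_s _).mono (R.le β)
  π_s h := A.π_s (R.le _ h)
  idx α β h := A.idx (R.ρ α) (R.ρ β) (h.mono (Set.inter_subset_inter (R.le α) (R.le β)))
  mem_dom hα hβ := A.mem_dom (R.le _ hα) (R.le _ hβ)

/-- Continuous logarithms `w` of `g` complete the sections and frames to local data: the cocycle
property of `g` makes `δ w` integral. -/
theorem nonempty_localData (w : (τ : Fin 3 → A.𝒰.ι) → A.𝒰.inter τ → ℝ)
    (hw : ∀ τ, Continuous (w τ))
    (hg : ∀ τ x, Complex.exp (2 * Real.pi * Complex.I * w τ x) =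
      A.g (τ 0) (τ 1) (τ 2) (x.2 0) (x.2 1) (x.2 2)) : Nonempty G.LocalData := by
  have : ∀ τ : Fin 4 → A.𝒰.ι, ∃ n : LocallyConstant (A.𝒰.inter τ) ℤ, ∀ x, (n x : ℝ) =
      ∑ k : Fin 4, (-1 : ℝ) ^ (k : ℕ) * w (τ ∘ k.succAbove) (A.𝒰.face τ k x) := by
    intro τ
    refine CechZ.exists_locallyConstant_eq (continuous_finsetSum _ fun k _ =>
      continuous_const.mul ((hw _).comp (A.𝒰.face τ k).continuous)) fun x => ?_
    have h0 := hg (τ ∘ (0 : Fin 4).succAbove) (A.𝒰.face τ 0 x)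
    have h1 := hg (τ ∘ (1 : Fin 4).succAbove) (A.𝒰.face τ 1 x)
    have h2 := hg (τ ∘ (2 : Fin 4).succAbove) (A.𝒰.face τ 2 x)
    have h3 := hg (τ ∘ (3 : Fin 4).succAbove) (A.𝒰.face τ 3 x)
    have key := A.g_mul_g (τ 0) (τ 1) (τ 2) (τ 3) (x.2 0) (x.2 1) (x.2 2) (x.2 3)
    change _ = A.g (τ 1) (τ 2) (τ 3) (x.2 1) (x.2 2) (x.2 3) at h0
    change _ = A.g (τ 0) (τ 2) (τ 3) (x.2 0) (x.2 2) (x.2 3) at h1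
    change _ = A.g (τ 0) (τ 1) (τ 3) (x.2 0) (x.2 1) (x.2 3) at h2
    change _ = A.g (τ 0) (τ 1) (τ 2) (x.2 0) (x.2 1) (x.2 2) at h3
    rw [← h0, ← h1, ← h2, ← h3, ← Complex.exp_add, ← Complex.exp_add] at key
    refine Eq.trans ?_ ((div_eq_one_iff_eq (Complex.exp_ne_zero _)).2 key.symm)
    rw [← Complex.exp_sub, Fin.sum_univ_four]
    congr 1
    push_cast
    simp only [Fin.val_zero, Fin.val_one, Fin.val_two, show ((3 : Fin 4) : ℕ) = 3 from rfl]
    ring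
  choose n hn using this
  refine ⟨⟨A.𝒰, A.s, A.smooth_s, A.π_s, A.σ, A.norm_σ, A.smooth_σ, w, hw, fun τ x => ?_, ⟨n, ?_⟩,
    hn⟩⟩
  · rw [hg, mul_σ]
  · change CechZ.d A.𝒰 3 n = 0
    funext τ
    ext x
    rw [CechZ.d_apply]
    have h := A.𝒰.sum_sum_face_eq_zero w τ x
    simp_rw [← hn] at h
    exact_mod_cast h

end LocalFrames

theorem nonempty_localFrames [IsManifold 𝓘(ℝ, EX) ∞ X] [IsManifold 𝓘(ℝ, EY) ∞ Y]
    [T2Space X] [ParacompactSpace X] : Nonempty G.LocalFrames := by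
  choose y hy using G.surjective
  choose U s hU hyU hs hπ using fun x => exists_contMDiffOn_section G.submersion (y x)
  let 𝒰 : CechZ.OpenCover X := ⟨X, U, hU, fun x => ⟨x, by simpa only [hy] using hyU x⟩⟩
  let q : (τ : Fin 2 → X) → 𝒰.inter τ → Y2 π := fun τ z =>
    pair ((hπ _ _ (z.2 0)).trans (hπ _ _ (z.2 1)).symm)
  have hsc : ∀ (τ : Fin 2 → X) k, Continuous fun z : 𝒰.inter τ => s (τ k) z := fun τ k =>
    (hs (τ k)).continuousOn.comp_continuous continuous_subtype_val fun z => z.2 k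
  have hq : ∀ τ, Continuous (q τ) := fun τ => ((hsc τ 0).prodMk (hsc τ 1)).subtype_mk _
  choose i hi using G.L.exists_mem_dom
  obtain ⟨𝒱, R, h𝒱⟩ := 𝒰.exists_refinement_inter_subset
    (fun τ x => {z | ∀ (hx : x ∈ 𝒰.inter τ) (hz : z ∈ 𝒰.inter τ),
      q τ ⟨z, hz⟩ ∈ G.L.dom (i (q τ ⟨x, hx⟩))}) (by
    intro τ x hx
    have h1 : q τ ⁻¹' G.L.dom (i (q τ ⟨x, hx⟩)) ∈ 𝓝 (⟨x, hx⟩ : 𝒰.inter τ) :=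
      (hq τ).continuousAt.preimage_mem_nhds ((G.L.isOpen_dom _).mem_nhds (hi _))
    rw [mem_nhds_subtype_iff_nhdsWithin, (𝒰.isOpen_inter τ).nhdsWithin_eq hx] at h1
    filter_upwards [h1] with z hz _ hz'
    obtain ⟨y, hy, rfl⟩ := hz
    exact hy)
  have hτ : ∀ {α β : 𝒱.ι} {x : X}, x ∈ 𝒱.U α → x ∈ 𝒱.U β → x ∈ 𝒱.inter ![α, β] :=
    fun hα hβ => Fin.forall_fin_two.2 ⟨hα, hβ⟩
  choose c hc hc' using h𝒱
  exact ⟨⟨𝒱, fun α => s (R.ρ α), fun α => (hs _).mono (R.le α), fun h => hπ _ _ (R.le _ h),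
    fun α β h => i (q _ ⟨c ![α, β] (h.imp fun x hx => hτ hx.1 hx.2), hc _ _⟩),
    fun {α β x} hα hβ => hc' ![α, β] ⟨x, hτ hα hβ⟩ (hτ hα hβ) (hc _ _)
      (R.incl _ ⟨x, hτ hα hβ⟩).2⟩⟩

theorem nonempty_localData [IsManifold 𝓘(ℝ, EX) ∞ X] [IsManifold 𝓘(ℝ, EY) ∞ Y]
    [T2Space X] [ParacompactSpace X] : Nonempty G.LocalData := by
  obtain ⟨A⟩ := G.nonempty_localFrames
  obtain ⟨𝒱, R, u, hu, hg⟩ := A.𝒰.exists_refinement_exp_eq (p := 2)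
    (fun τ x => A.g (τ 0) (τ 1) (τ 2) (x.2 0) (x.2 1) (x.2 2)) A.continuous_g
    fun τ x => A.norm_g _ _ _ _ _ _
  exact (A.restrict R).nonempty_localData u hu hg

end BundleGerbe

end Gerbe

/-! ### The determinants of the transition matrices of a module -/

namespace Gerbe

universe u v w v' w'

variable {EX EY : Type*} [NormedAddCommGroup EX] [NormedSpace ℝ EX]
  [NormedAddCommGroup EY] [NormedSpace ℝ EY]
  {X : Type u} [TopologicalSpace X] [ChartedSpace EX X]
  {Y : Type*} [TopologicalSpace Y] [ChartedSpace EY Y]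

namespace BundleGerbe

variable {π : Y → X} {G : BundleGerbe.{v, w} EX EY π}

namespace GerbeModule

variable {r : ℕ} (E : G.GerbeModule r)

/-- The matrix, in the frames `k` and `k'` of the module, of the action of an element of `L`. -/
def actMatrix (k k' : E.E.ι) {y₁ y₂ : Y} (h : π y₁ = π y₂) (a : G.L.fiber (pair h)) :
    Matrix (Fin r) (Fin r) ℂ :=
  Matrix.of fun i j => inner ℂ (E.E.frame k i y₁) (E.act h (a ⊗ₜ E.E.frame k' j y₂))

theorem actMatrix_smul (k k' : E.E.ι) {y₁ y₂ : Y} (h : π y₁ = π y₂) (c : ℂ)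
    (a : G.L.fiber (pair h)) : E.actMatrix k k' h (c • a) = c • E.actMatrix k k' h a := by
  ext i j
  simp [actMatrix, ← TensorProduct.smul_tmul']

theorem actMatrix_mul (k k' k'' : E.E.ι) {y₁ y₂ y₃ : Y} (h : π y₁ = π y₂) (h' : π y₂ = π y₃)
    (hk' : y₂ ∈ E.E.dom k') (a : G.L.fiber (pair h)) (b : G.L.fiber (pair h')) :
    E.actMatrix k k'' (h.trans h') (G.mul h h' (a ⊗ₜ b)) =
      E.actMatrix k k' h a * E.actMatrix k' k'' h' b := by
  ext i j
  simp only [actMatrix, Matrix.of_apply, Matrix.mul_apply]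
  rw [E.mul_act, ← E.E.sum_inner_smul_frame hk' (E.act h' (b ⊗ₜ E.E.frame k'' j y₃)),
    TensorProduct.tmul_sum, map_sum, inner_sum]
  refine Finset.sum_congr rfl fun l _ => ?_
  rw [TensorProduct.tmul_smul, map_smul, inner_smul_right, mul_comm,
    E.E.sum_inner_smul_frame hk']

/-- Unit elements of `L` act unitarily. -/
theorem norm_det_actMatrix {k k' : E.E.ι} {y₁ y₂ : Y} (h : π y₁ = π y₂) (hk : y₁ ∈ E.E.dom k)
    (hk' : y₂ ∈ E.E.dom k') {a : G.L.fiber (pair h)} (ha : ‖a‖ = 1) :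
    ‖(E.actMatrix k k' h a).det‖ = 1 := by
  have hu : E.actMatrix k k' h a ∈ Matrix.unitaryGroup (Fin r) ℂ := by
    rw [Matrix.mem_unitaryGroup_iff']
    ext j l
    simp only [Matrix.star_eq_conjTranspose, Matrix.mul_apply, Matrix.conjTranspose_apply,
      actMatrix, Matrix.of_apply, RCLike.star_def, inner_conj_symm]
    rw [E.E.sum_inner_mul_inner_frame hk, LinearIsometryEquiv.inner_map_map,
      TensorProduct.inner_tmul, inner_self_eq_norm_sq_to_K, ha, Matrix.one_apply,
      orthonormal_iff_ite.1 (E.E.orthonormal k' y₂ hk') j l]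
    simp
  exact CStarRing.norm_of_mem_unitary (Matrix.det_of_mem_unitary hu)

end GerbeModule

/-! ### Torsion of the Dixmier–Douady class -/

namespace LocalData

variable (D : G.LocalData) {r : ℕ}

theorem continuousOn_s (α : D.𝒰.ι) : ContinuousOn (D.s α) (D.𝒰.U α) :=
  (D.smooth_s α).continuousOn

/-- After refining the cover, each pullback `s_α⁻¹ E` is trivialised by a single frame. -/
theorem exists_refinement_frame (E : G.GerbeModule r) :
    ∃ (𝒱 : CechZ.OpenCover X) (R : CechZ.Refinement 𝒱 D.𝒰)
    (k : 𝒱.ι → E.E.ι), ∀ β, ∀ x ∈ 𝒱.U β, D.s (R.ρ β) x ∈ E.E.dom (k β) := by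
  choose α hα using D.𝒰.exists_mem
  choose k hk using fun x => E.E.exists_mem_dom (D.s (α x) x)
  exact ⟨⟨X, fun x => D.𝒰.U (α x) ∩ D.s (α x) ⁻¹' E.E.dom (k x), fun x =>
    (D.continuousOn_s (α x)).isOpen_inter_preimage (D.𝒰.isOpen _) (E.E.isOpen_dom _),
    fun x => ⟨x, hα x, hk x⟩⟩, ⟨α, fun x => Set.inter_subset_left⟩, k, fun β x hx => hx.2⟩

theorem continuousAt_actMatrix (E : G.GerbeModule r) (k k' : E.E.ι) (α β : D.𝒰.ι)
    (x : {x : X // x ∈ D.𝒰.U α ∧ x ∈ D.𝒰.U β}) (hk : D.s α x ∈ E.E.dom k)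
    (hk' : D.s β x ∈ E.E.dom k') :
    ContinuousAt (fun z : {x : X // x ∈ D.𝒰.U α ∧ x ∈ D.𝒰.U β} =>
      E.actMatrix k k' _ (D.σ α β z.2.1 z.2.2)) x := by
  let q : {x : X // x ∈ D.𝒰.U α ∧ x ∈ D.𝒰.U β} → Y2 π := fun z =>
    pair ((D.π_s z.2.1).trans (D.π_s z.2.2).symm)
  have hq : Continuous q := (((D.continuousOn_s α).comp_continuous continuous_subtype_val
    fun z : {x : X // x ∈ D.𝒰.U α ∧ x ∈ D.𝒰.U β} => z.2.1).prodMk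
      ((D.continuousOn_s β).comp_continuous continuous_subtype_val
    fun z : {x : X // x ∈ D.𝒰.U α ∧ x ∈ D.𝒰.U β} => z.2.2)).subtype_mk _
  obtain ⟨i, hi⟩ := G.L.exists_mem_dom (q x)
  have h1 := (D.smooth_σ α β i x hi).continuousAt continuousAt_subtype_val
  have h2 : ContinuousAt (fun z => E.actMatrix k k' (q z).2 (G.L.frame i 0 (q z))) x := by
    refine continuousAt_pi.2 fun a' => continuousAt_pi.2 fun a => ?_
    exact ContinuousAt.comp (f := q) ((E.smooth_act i k' k a a' (q x) hi hk' hk).continuousAt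
      continuousAt_subtype_val) hq.continuousAt
  refine (h1.smul h2).congr ?_
  filter_upwards [hq.continuousAt.preimage_mem_nhds ((G.L.isOpen_dom i).mem_nhds hi)] with z hz
  rw [Pi.smul_apply', ← E.actMatrix_smul, G.L.inner_smul_frame hz]

/-- A module of rank `r` makes `r` times the cocycle of any local data a coboundary on a
refinement: the determinants of the action trivialise `gʳ`. -/
theorem nsmul_mk_eq_zero [T2Space X] [ParacompactSpace X] (E : G.GerbeModule r) :
    r • CechZ.H.mk D.𝒰 D.n = 0 := by
  obtain ⟨𝒱, R, k, hk⟩ := D.exists_refinement_frame E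
  let A : ∀ (a b : 𝒱.ι) {x : X}, x ∈ 𝒱.U a → x ∈ 𝒱.U b → Matrix (Fin r) (Fin r) ℂ :=
    fun a b x ha hb => E.actMatrix (k a) (k b) _ (D.σ (R.ρ a) (R.ρ b) (R.le _ ha) (R.le _ hb))
  have hAc : ∀ τ : Fin 2 → 𝒱.ι,
      Continuous fun x : 𝒱.inter τ => A (τ 0) (τ 1) (x.2 0) (x.2 1) := by
    refine fun τ => continuous_iff_continuousAt.2 fun x => ?_
    let f : 𝒱.inter τ → {x : X // x ∈ D.𝒰.U (R.ρ (τ 0)) ∧ x ∈ D.𝒰.U (R.ρ (τ 1))} :=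
      fun z => ⟨z.1, R.le _ (z.2 0), R.le _ (z.2 1)⟩
    have hf : Continuous f := continuous_subtype_val.subtype_mk _
    exact ContinuousAt.comp (f := f) (x := x) (D.continuousAt_actMatrix E _ _ _ _ (f x)
      (hk _ _ (x.2 0)) (hk _ _ (x.2 1))) hf.continuousAt
  obtain ⟨𝒲, S, u, hu, hexp⟩ := 𝒱.exists_refinement_exp_eq (p := 1)
    (fun τ x => (A (τ 0) (τ 1) (x.2 0) (x.2 1)).det) (fun τ => (hAc τ).matrix_det)
    fun τ x => E.norm_det_actMatrix _ (hk _ _ (x.2 0)) (hk _ _ (x.2 1)) (D.norm_σ _ _ _ _)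
  let T : CechZ.Refinement 𝒲 D.𝒰 := ⟨R.ρ ∘ S.ρ, fun β => (S.le β).trans (R.le _)⟩
  -- Since `gʳ = δ (det A)`, the cochain `r w - δ u` is integral; its coboundary is `r n`.
  have : ∀ τ : Fin 3 → 𝒲.ι, ∃ m : LocallyConstant (𝒲.inter τ) ℤ, ∀ x, (m x : ℝ) =
      r * D.w (T.ρ ∘ τ) (T.incl τ x) -
        ∑ k : Fin 3, (-1 : ℝ) ^ (k : ℕ) * u (τ ∘ k.succAbove) (𝒲.face τ k x) := by
    intro τ
    refine CechZ.exists_locallyConstant_eq ((continuous_const.mul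
      ((D.continuous_w _).comp (T.incl τ).continuous)).sub (continuous_finsetSum _ fun k _ =>
      continuous_const.mul ((hu _).comp (𝒲.face τ k).continuous))) fun x => ?_
    have h0 := hexp (τ ∘ (0 : Fin 3).succAbove) (𝒲.face τ 0 x)
    have h1 := hexp (τ ∘ (1 : Fin 3).succAbove) (𝒲.face τ 1 x)
    have h2 := hexp (τ ∘ (2 : Fin 3).succAbove) (𝒲.face τ 2 x)
    have hA : ∀ i, x.1 ∈ 𝒱.U (S.ρ (τ i)) := fun i => S.le _ (x.2 i)
    change _ = (A (S.ρ (τ 1)) (S.ρ (τ 2)) (hA 1) (hA 2)).det at h0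
    change _ = (A (S.ρ (τ 0)) (S.ρ (τ 2)) (hA 0) (hA 2)).det at h1
    change _ = (A (S.ρ (τ 0)) (S.ρ (τ 1)) (hA 0) (hA 1)).det at h2
    have key : Complex.exp (2 * Real.pi * Complex.I * D.w (T.ρ ∘ τ) (T.incl τ x)) •
        A (S.ρ (τ 0)) (S.ρ (τ 2)) (hA 0) (hA 2) =
        A (S.ρ (τ 0)) (S.ρ (τ 1)) (hA 0) (hA 1) * A (S.ρ (τ 1)) (S.ρ (τ 2)) (hA 1) (hA 2) := by
      refine Eq.trans ?_ (E.actMatrix_mul _ _ _ _ _ (hk _ _ (hA 1)) _ _)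
      refine (E.actMatrix_smul _ _ _ _ _).symm.trans ?_
      exact congrArg _ (D.mul_σ (T.ρ ∘ τ) (T.incl τ x)).symm
    replace key := congrArg Matrix.det key
    rw [Matrix.det_smul, Matrix.det_mul, Fintype.card_fin, ← h0, ← h1, ← h2, ← Complex.exp_nat_mul,
      ← Complex.exp_add, ← Complex.exp_add] at key
    refine Eq.trans ?_ ((div_eq_one_iff_eq (Complex.exp_ne_zero _)).2 key)
    rw [← Complex.exp_sub, Fin.sum_univ_three]
    congr 1
    push_cast
    simp only [Fin.val_zero, Fin.val_one, Fin.val_two]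
    ring
  choose m hm using this
  refine CechZ.H.nsmul_mk_eq_zero T r D.n m ?_
  funext τ
  ext x
  have hn : (r • T.pull 3 D.n.1) τ x = r * D.n.1 (T.ρ ∘ τ) (T.incl τ x) := by
    change (r • (T.pull 3 D.n.1 τ)) x = _
    rw [LocallyConstant.smul_apply, nsmul_eq_mul]
    rfl
  rw [CechZ.d_apply, hn]
  have h := 𝒲.sum_sum_face_eq_zero u τ x
  have hnx := D.n_eq (T.ρ ∘ τ) (T.incl τ x)
  have : ∑ k : Fin 4, (-1 : ℝ) ^ (k : ℕ) * (m (τ ∘ k.succAbove) (𝒲.face τ k x) : ℝ) =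
      r * (D.n.1 (T.ρ ∘ τ) (T.incl τ x) : ℝ) := by
    simp_rw [hm, mul_sub, Finset.sum_sub_distrib]
    rw [h, sub_zero, hnx, Finset.mul_sum]
    exact Finset.sum_congr rfl fun k _ => mul_left_comm _ _ _
  exact_mod_cast this

end LocalData

end BundleGerbe

end Gerbe

end

theorem mainTheorem7
    {EX EY : Type*} [NormedAddCommGroup EX] [NormedSpace ℝ EX] [FiniteDimensional ℝ EX]
    [NormedAddCommGroup EY] [NormedSpace ℝ EY] [CompleteSpace EY]
    {X : Type*} [TopologicalSpace X] [T2Space X] [ParacompactSpace X]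
    [ChartedSpace EX X] [IsManifold 𝓘(ℝ, EX) ∞ X]
    {Y : Type*} [TopologicalSpace Y] [ChartedSpace EY Y] [IsManifold 𝓘(ℝ, EY) ∞ Y]
    {π : Y → X} (G : Gerbe.BundleGerbe EX EY π) (r : ℕ) (E : G.GerbeModule r) :
    (∃ d : CechZ.H X 3, G.IsDixmierDouadyClass d) ∧
      ∀ d : CechZ.H X 3, G.IsDixmierDouadyClass d → r • d = 0 := by
  refine ⟨?_, ?_⟩
  · obtain ⟨D⟩ := G.nonempty_localData
    exact ⟨_, D, rfl⟩
  · rintro _ ⟨D, rfl⟩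
    exact D.nsmul_mk_eq_zero E
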